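/- A sign pattern is a square matrix with entries in $\{+,-,0\}$; products and powers are formed with the usual sign rules, where a sum containing both a $+$ and a $-$ is an ambiguous entry $\#$ (so $\#+x=\#$, $\#\cdot 0=0$, and $\#\cdot x=\#$ for $x\neq 0$). A sign pattern $A$ is sign $k$-potent if $k$ is the smallest positive integer with $A^{k+1}=A$. It allows $k$-potence if there is a real matrix $B$ with $\operatorname{sgn}(b_{ij})=a_{ij}$ for all $i,j$ and $B^{k+1}=B$. A symmetric block partition of $A$ partitions the rows and the columns into the same intervals of consecutive indices. The coarsest block partition of $A$ is the coarsest symmetric block partition for which each block has the form $\alpha J$ with $\alpha\in\{+,-,0\}$ and $J$ an all-$+$ block; the reduced block matrix $\operatorname{red}(A)$ is the sign pattern whose $(s,t)$ entry is the coefficient $\alpha_{st}$ of the $(s,t)$ block of this partition. $A$ is reducible if some simultaneous permutation of its rows and columns brings it to the form $\begin{bmatrix}A_{11}&A_{12}\\0&A_{22}\end{bmatrix}$ with nonvacuous square diagonal blocks, and irreducible otherwise. Let $P_m$ be the $m\times m$ sign pattern with $+$ on the first superdiagonal and in position $(m,1)$ and $0$ elsewhere, and let $Q_m$ be $P_m$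 with the entry in position $(m,1)$ replaced by $-$ (so $P_1=[+]$, $Q_1=[-]$). $A$ is in cyclic normal form if, for some symmetric block partition, it is block upper triangular with irreducible diagonal blocks $A_{ii}$, each of which is either a $1\times1$ zero block or satisfies $\operatorname{red}(A_{ii})\in\{P_m,Q_m\}$ for some $m\ge 1$. Theorem. Let $k\ge 1$ and let $A$ be a reducible sign $k$-potent sign pattern in cyclic normal form. Then $A$ allows $k$-potence if and only if $\operatorname{red}(A)$ allows $k$-potence. -/

import Mathlib

namespace SignPattern

/-- A (square) sign pattern of order `n`: a matrix with entries in `{+, -, 0}`. -/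
abbrev Pattern (n : ℕ) : Type := Matrix (Fin n) (Fin n) SignType

/-! ### Sign arithmetic with the ambiguous entry `#` -/

/-- The generalized signs `0, +, -, #`, where `# = (+) + (-)` is the ambiguous sign. -/
inductive GenSign : Type
  | zero
  | pos
  | neg
  | amb
  deriving DecidableEq

namespace GenSign

/-- `0` is neutral, `(+) + (+) = +`, `(-) + (-) = -`, and every other sum is ambiguous. -/
def add : GenSign → GenSign → GenSign
  | zero, b => b
  | a, zero => a
  | pos, pos => pos
  | neg, neg => neg
  | _, _ => amb

/-- `0` is absorbing, `+` is neutral, `(-)(-) = +`, and `#` times a nonzero sign is `#`. -/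
def mul : GenSign → GenSign → GenSign
  | zero, _ => zero
  | _, zero => zero
  | pos, b => b
  | a, pos => a
  | neg, neg => pos
  | _, _ => amb

instance : Zero GenSign := ⟨zero⟩

instance : Add GenSign := ⟨add⟩

/-- The generalized signs form a commutative semiring, so that powers of matrices over them
are Mathlib's. -/
instance : CommSemiring GenSign where
  mul := mul
  one := pos
  nsmul := nsmulRec
  add_assoc := by intro a b c; cases a <;> cases b <;> cases c <;> rfl
  zero_add := by intro a; cases a <;> rfl
  add_zero := by intro a; cases a <;> rfl
  add_comm := by intro a b; cases a <;> cases b <;> rfl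
  mul_assoc := by intro a b c; cases a <;> cases b <;> cases c <;> rfl
  one_mul := by intro a; cases a <;> rfl
  mul_one := by intro a; cases a <;> rfl
  zero_mul := by intro a; cases a <;> rfl
  mul_zero := by intro a; cases a <;> rfl
  mul_comm := by intro a b; cases a <;> cases b <;> rfl
  left_distrib := by intro a b c; cases a <;> cases b <;> cases c <;> rfl
  right_distrib := by intro a b c; cases a <;> cases b <;> cases c <;> rfl

/-- The unambiguous generalized signs. -/
def ofSign : SignType → GenSign
  | SignType.zero => zero
  | SignType.pos => pos
  | SignType.neg => neg

end GenSign

/-- The sign pattern `A`, read as a matrix over the generalized signs. -/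
def gen {n : ℕ} (A : Pattern n) : Matrix (Fin n) (Fin n) GenSign := A.map GenSign.ofSign

/-- `A` is sign `k`-potent: `k` is the smallest positive integer such that `A ^ (k + 1) = A`
(in particular `A ^ (k + 1)` has no ambiguous entry). -/
def IsSignKPotent {n : ℕ} (k : ℕ) (A : Pattern n) : Prop :=
  IsLeast {j : ℕ | 0 < j ∧ gen A ^ (j + 1) = gen A} k

/-! ### Qualitative class -/

/-- The qualitative class of `A`: all real matrices with sign pattern `A`. -/
def qualitativeClass {n : ℕ} (A : Pattern n) : Set (Matrix (Fin n) (Fin n) ℝ) :=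
  {B | ∀ i j, SignType.sign (B i j) = A i j}

/-- `A` allows `k`-potence: some real matrix `B` with sign pattern `A` has `B ^ (k + 1) = B`. -/
def AllowsKPotence {n : ℕ} (k : ℕ) (A : Pattern n) : Prop :=
  ∃ B ∈ qualitativeClass A, B ^ (k + 1) = B

/-! ### Block partitions and the reduced block matrix

A symmetric block partition of an `n × n` matrix cuts the rows and the columns into the same
nonempty intervals of consecutive indices, that is, it is a composition of `n`. -/

/-- Every block of `A` in the symmetric block partition `c` is of the form `α J`. -/
def IsConstantOnBlocks {n : ℕ} (A : Pattern n) (c : Composition n) : Prop :=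
  ∀ i i' j j' : Fin n, c.index i = c.index i' → c.index j = c.index j' → A i j = A i' j'

/-- `c` is a coarsest partition of `A` into blocks of the form `α J`: it is not a proper
subpartition of another one. (Coarser partitions have fewer boundaries.) -/
def IsCoarsest {n : ℕ} (A : Pattern n) (c : Composition n) : Prop :=
  MinimalFor (IsConstantOnBlocks A) Composition.boundaries c

theorem isConstantOnBlocks_ones {n : ℕ} (A : Pattern n) :
    IsConstantOnBlocks A (Composition.ones n) := by
  have key : ∀ i i' : Fin n,
      (Composition.ones n).index i = (Composition.ones n).index i' → i = i' := by
    intro i i' h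
    have h1 := (Composition.ones n).sizeUpTo_index_le i
    have h2 := (Composition.ones n).lt_sizeUpTo_index_succ i
    have h3 := (Composition.ones n).sizeUpTo_index_le i'
    have h4 := (Composition.ones n).lt_sizeUpTo_index_succ i'
    rw [← h] at h3 h4
    simp only [Composition.ones_sizeUpTo, Fin.val_succ] at h1 h2 h3 h4
    apply Fin.ext
    omega
  intro i i' j j' hi hj
  rw [key i i' hi, key j j' hj]

theorem exists_isCoarsest {n : ℕ} (A : Pattern n) : ∃ c : Composition n, IsCoarsest A c :=
  exists_minimalFor_of_wellFoundedLT _ _ ⟨_, isConstantOnBlocks_ones A⟩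

/-- The coarsest block partition of `A`. -/
noncomputable def coarsest {n : ℕ} (A : Pattern n) : Composition n := (exists_isCoarsest A).choose

/-- The number of blocks of the coarsest block partition, i.e. the order of `red A`. -/
noncomputable def redOrder {n : ℕ} (A : Pattern n) : ℕ := (coarsest A).length

/-- The reduced block matrix: its `(s, t)` entry is the common value of the entries of `A` in the
`(s, t)` block of the coarsest block partition (read off at the first entry of the block). -/
noncomputable def red {n : ℕ} (A : Pattern n) : Pattern (redOrder A) := fun s t =>
  A ((coarsest A).embedding s ⟨0, (coarsest A).one_le_blocksFun s⟩)
    ((coarsest A).embedding t ⟨0, (coarsest A).one_le_blocksFun t⟩)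

/-! ### Reducibility and normal forms -/

/-- `A` is reducible: after a simultaneous permutation of the rows and columns it has the form
`[A₁₁ A₁₂; 0 A₂₂]` with nonvacuous square `A₁₁` (of order `r`) and `A₂₂` (of order `n - r`). -/
def IsReducible {n : ℕ} (A : Pattern n) : Prop :=
  ∃ (σ : Equiv.Perm (Fin n)) (r : ℕ), 0 < r ∧ r < n ∧
    ∀ i j : Fin n, r ≤ (i : ℕ) → (j : ℕ) < r → A.submatrix σ σ i j = 0

/-- `A` is irreducible; note that every `1 × 1` pattern is irreducible. -/
def IsIrreducible {n : ℕ} (A : Pattern n) : Prop := ¬ IsReducible A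

/-- The `s`-th diagonal block of `A` in the symmetric block partition `c`. -/
def diagBlock {n : ℕ} (A : Pattern n) (c : Composition n) (s : Fin c.length) :
    Pattern (c.blocksFun s) :=
  A.submatrix (c.embedding s) (c.embedding s)

/-- `A` is in Frobenius normal form with respect to the block partition `c`: block upper
triangular with irreducible diagonal blocks (some of which may be `1 × 1` zero blocks). -/
structure IsFrobeniusNormalForm {n : ℕ} (A : Pattern n) (c : Composition n) : Prop where
  upper : ∀ i j : Fin n, c.index j < c.index i → A i j = 0
  irreducible : ∀ s : Fin c.length, IsIrreducible (diagBlock A c s)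

/-- The `m × m` pattern with `+` on the first superdiagonal, `ε` in the lower left corner and
`0` elsewhere. -/
def cyclicPattern (ε : SignType) (m : ℕ) : Pattern m := fun i j =>
  if (i : ℕ) + 1 = (j : ℕ) then 1 else if (i : ℕ) + 1 = m ∧ (j : ℕ) = 0 then ε else 0

/-- The circulant permutation pattern `P_m`. -/
def patternP (m : ℕ) : Pattern m := cyclicPattern 1 m

/-- `Q_m` is `P_m` with the `+` in the lower left corner replaced by `-`. -/
def patternQ (m : ℕ) : Pattern m := cyclicPattern (-1) m

/-- `A` is in cyclic normal form: it is in Frobenius normal form, and each diagonal block is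
either a `1 × 1` zero block or has a reduced block matrix `P_m` or `Q_m` for some `m` (which is
necessarily the order of the reduced block matrix). -/
def IsCyclicNormalForm {n : ℕ} (A : Pattern n) : Prop :=
  ∃ c : Composition n, IsFrobeniusNormalForm A c ∧
    ∀ s : Fin c.length,
      (c.blocksFun s = 1 ∧ diagBlock A c s = 0) ∨
      red (diagBlock A c s) = patternP (redOrder (diagBlock A c s)) ∨
      red (diagBlock A c s) = patternQ (redOrder (diagBlock A c s))

end SignPattern

/-!
Let `B` be `k`-potent with sign pattern `A`. Since `A ^ (k + 1)` has no ambiguous entry, no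
cancellation occurs in `B ^ (k + 1)`, so `|B|` is `k`-potent too and `|B| ^ k` is a nonnegative
idempotent. Rows of a nonnegative idempotent that belong to the same strongly connected class are
proportional, and indices in the same block of `A` belong to one class as soon as their rows and
columns in `A` are nonzero. Hence the rows of `B` inside a block are positive multiples of one
another, unless the columns of the block vanish, and `B` can be compressed to a `k`-potent matrix
with one row and one column per block. Conversely, a `k`-potent matrix with pattern `red A` is
expanded by spreading each of its columns evenly over the corresponding block.
-/

namespace SignPattern

open Matrix

theorem exists_rel_self_between {α : Type*} [Finite α] {r : α → α → Prop} [IsTrans α r]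
    (hdense : ∀ x y, r x y → ∃ z, r x z ∧ r z y) {x y : α} (hxy : r x y) :
    ∃ z, r x z ∧ r z z ∧ r z y := by
  let s : α → α → Prop := fun a b => r a b ∧ ¬ r b a
  have : IsTrans α s :=
    ⟨fun _ _ _ hab hbc => ⟨_root_.trans hab.1 hbc.1, fun hca => hab.2 (_root_.trans hbc.1 hca)⟩⟩
  have : Std.Irrefl s := ⟨fun _ h => h.2 h.1⟩
  obtain ⟨m, ⟨hxm, hmy⟩, hmin⟩ :=
    (Finite.wellFounded_of_trans_of_irrefl s).has_min {z | r x z ∧ r z y} (hdense x y hxy)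
  obtain ⟨l, hxl, hlm⟩ := hdense x m hxm
  have hml : r m l := by
    by_contra hml
    exact hmin l ⟨hxl, _root_.trans hlm hmy⟩ ⟨hlm, hml⟩
  exact ⟨m, hxm, _root_.trans hml hlm, hmy⟩

section NonnegativeMatrix

variable {ι κ μ R : Type*} [Fintype κ] [Semiring R] [LinearOrder R] [IsStrictOrderedRing R]

theorem mul_apply_pos_iff {M : Matrix ι κ R} {N : Matrix κ μ R} (hM : ∀ i j, 0 ≤ M i j)
    (hN : ∀ i j, 0 ≤ N i j) {i : ι} {j : μ} :
    0 < (M * N) i j ↔ ∃ l, 0 < M i l ∧ 0 < N l j := by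
  rw [mul_apply, Finset.sum_pos_iff_of_nonneg fun l _ => mul_nonneg (hM i l) (hN l j)]
  simp only [Finset.mem_univ, true_and]
  refine exists_congr fun l => ⟨fun h => ?_, fun h => mul_pos h.1 h.2⟩
  exact ⟨(hM i l).lt_of_ne' (left_ne_zero_of_mul h.ne'),
    (hN l j).lt_of_ne' (right_ne_zero_of_mul h.ne')⟩

theorem vecMul_apply_eq_zero_iff [NoZeroDivisors R] {v : κ → R} {M : Matrix κ μ R}
    (hv : ∀ l, 0 ≤ v l) (hM : ∀ i j, 0 ≤ M i j) {m : μ} :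
    (v ᵥ* M) m = 0 ↔ ∀ l, v l = 0 ∨ M l m = 0 := by
  rw [vecMul, dotProduct, Finset.sum_eq_zero_iff_of_nonneg fun l _ => mul_nonneg (hv l) (hM l m)]
  simp only [Finset.mem_univ, true_imp_iff, mul_eq_zero]

end NonnegativeMatrix

section Idempotent

variable {ι R : Type*} [Fintype ι]

section Semiring

variable [Semiring R] [LinearOrder R] [IsStrictOrderedRing R] {F : Matrix ι ι R}

theorem apply_pos_iff_of_idempotent (h0 : ∀ i j, 0 ≤ F i j) (hF : IsIdempotentElem F)
    {i j : ι} : 0 < F i j ↔ ∃ l, 0 < F i l ∧ 0 < F l j := by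
  rw [← mul_apply_pos_iff h0 h0, hF.eq]

theorem apply_pos_trans_of_idempotent (h0 : ∀ i j, 0 ≤ F i j) (hF : IsIdempotentElem F) {i j l : ι}
    (hij : 0 < F i j) (hjl : 0 < F j l) : 0 < F i l :=
  (apply_pos_iff_of_idempotent h0 hF).2 ⟨j, hij, hjl⟩

theorem exists_diag_pos_between_of_idempotent (h0 : ∀ i j, 0 ≤ F i j) (hF : IsIdempotentElem F)
    {i j : ι} (hij : 0 < F i j) : ∃ l, 0 < F i l ∧ 0 < F l l ∧ 0 < F l j :=
  have : IsTrans ι fun a b => 0 < F a b := ⟨fun _ _ _ => apply_pos_trans_of_idempotent h0 hF⟩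
  exists_rel_self_between (r := fun a b => 0 < F a b)
    (fun _ _ => (apply_pos_iff_of_idempotent h0 hF).1) hij

end Semiring

section Ring

variable [Ring R] [LinearOrder R] [IsStrictOrderedRing R] {F : Matrix ι ι R}

theorem row_eq_zero_of_idempotent (h0 : ∀ i j, 0 ≤ F i j) (hF : IsIdempotentElem F) {i l : ι}
    (hii : 0 < F i i) (hil : 0 < F i l) (hli : F l i = 0) : F l = 0 := by
  -- Truncate row `i` to the indices that lead back to `i`. Multiplication by `F` restores these
  -- entries and creates nonnegative others, among them a positive one at `l`; the difference `y`
  -- is annihilated by `F`.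
  let x : ι → R := fun a => if 0 < F a i then F i a else 0
  let y : ι → R := x ᵥ* F - x
  have hx : ∀ a, 0 ≤ x a := fun a => by dsimp only [x]; split_ifs <;> simp [h0]
  have hxF : ∀ b, 0 < F b i → (x ᵥ* F) b = x b := fun b hb => by
    calc (x ᵥ* F) b = ∑ a, F i a * F a b := by
          refine Finset.sum_congr rfl fun a _ => ?_
          rcases (h0 a b).eq_or_lt with hab | hab
          · simp only [← hab, mul_zero]
          · simp only [x, if_pos (apply_pos_trans_of_idempotent h0 hF hab hb)]
      _ = x b := by rw [← mul_apply, hF.eq]; exact (if_pos hb).symm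
  have hyF : y ᵥ* F = 0 := by rw [sub_vecMul, vecMul_vecMul, hF.eq, sub_self]
  have hy_of_not : ∀ b, ¬ 0 < F b i → y b = (x ᵥ* F) b := fun b hb => by
    simp only [y, Pi.sub_apply, x, if_neg hb, sub_zero]
  have hxF_nonneg : ∀ b, 0 ≤ (x ᵥ* F) b := fun b =>
    Finset.sum_nonneg fun a _ => mul_nonneg (hx a) (h0 a b)
  have hy : ∀ b, 0 ≤ y b := fun b => by
    by_cases hb : 0 < F b i
    · exact (sub_eq_zero.2 (hxF b hb)).ge
    · exact (hxF_nonneg b).trans_eq (hy_of_not b hb).symm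
  have hyl : y l ≠ 0 := by
    rw [hy_of_not l hli.le.not_gt]
    intro h
    rcases (vecMul_apply_eq_zero_iff hx h0).1 h i with hxi | h
    · exact hii.ne' ((if_pos hii).symm.trans hxi)
    · exact hil.ne' h
  funext m
  exact ((vecMul_apply_eq_zero_iff hy h0).1 (congrFun hyF m) l).resolve_left hyl

theorem diag_pos_of_idempotent (h0 : ∀ i j, 0 ≤ F i j) (hF : IsIdempotentElem F) {i j j' : ι}
    (hij : 0 < F i j) (hji : 0 < F j' i) : 0 < F i i := by
  obtain ⟨l, hil, hll, -⟩ := exists_diag_pos_between_of_idempotent h0 hF hij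
  obtain ⟨m, -, hmm, hmi⟩ := exists_diag_pos_between_of_idempotent h0 hF hji
  have hlm : 0 < F l m := by
    have hml : 0 < F m l := apply_pos_trans_of_idempotent h0 hF hmi hil
    refine (h0 l m).lt_of_ne' fun hlm => hll.ne' ?_
    exact congrFun (row_eq_zero_of_idempotent h0 hF hmm hml hlm) l
  exact apply_pos_trans_of_idempotent h0 hF hil (apply_pos_trans_of_idempotent h0 hF hlm hmi)

end Ring

theorem row_proportional_of_idempotent [Field R] [LinearOrder R] [IsStrictOrderedRing R]
    {F : Matrix ι ι R} (h0 : ∀ i j, 0 ≤ F i j) (hF : IsIdempotentElem F) {i j : ι}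
    (hij : 0 < F i j) (hji : 0 < F j i) : ∃ r : R, 0 < r ∧ F j = r • F i := by
  have hii : 0 < F i i := apply_pos_trans_of_idempotent h0 hF hij hji
  -- For the largest `r` with `v := F j - r • F i ≥ 0`, some entry of `v` at an index of the class
  -- vanishes, and this propagates because `v ᵥ* F = v`.
  obtain ⟨p, hp, hmin⟩ := Finset.exists_min_image {m | 0 < F i m} (fun m => F j m / F i m)
    ⟨i, by simpa using hii⟩
  simp only [Finset.mem_filter, Finset.mem_univ, true_and] at hp hmin
  set r := F j p / F i p with hr
  have hr_pos : 0 < r := div_pos (apply_pos_trans_of_idempotent h0 hF hji hp) hp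
  let v : ι → R := F j - r • F i
  have hv_apply : ∀ m, v m = F j m - r * F i m := fun _ => rfl
  have hv : ∀ m, 0 ≤ v m := fun m => by
    rw [hv_apply]
    rcases (h0 i m).eq_or_lt with him | him
    · rw [← him, mul_zero, sub_zero]
      exact h0 j m
    · exact sub_nonneg.2 ((le_div_iff₀ him).1 (hmin m him))
  have hvF : v ᵥ* F = v := by
    rw [sub_vecMul, smul_vecMul, ← mul_apply_eq_vecMul, ← mul_apply_eq_vecMul, hF.eq]
  have hvp : (v ᵥ* F) p = 0 := by
    rw [hvF, hv_apply, hr, div_mul_cancel₀ _ hp.ne', sub_self]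
  have hv_or_row : ∀ l, v l = 0 ∨ F l = 0 := fun l => by
    refine or_iff_not_imp_left.2 fun hvl => ?_
    have hjl : 0 < F j l := by
      have : 0 < v l := (hv l).lt_of_ne' hvl
      rw [hv_apply, sub_pos] at this
      exact (mul_nonneg hr_pos.le (h0 i l)).trans_lt this
    have hlp : F l p = 0 := ((vecMul_apply_eq_zero_iff hv h0).1 hvp l).resolve_left hvl
    refine row_eq_zero_of_idempotent h0 hF hii (apply_pos_trans_of_idempotent h0 hF hij hjl) ?_
    by_contra hli
    exact (apply_pos_trans_of_idempotent h0 hF ((h0 l i).lt_of_ne' hli) hp).ne' hlp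
  refine ⟨r, hr_pos, sub_eq_zero.1 ?_⟩
  change v = 0
  rw [← hvF]
  funext m
  exact (vecMul_apply_eq_zero_iff hv h0).2 fun l => (hv_or_row l).imp_right (congrFun · m)

end Idempotent

section Potent

theorem isIdempotentElem_pow_of_pow_succ_eq {M : Type*} [Monoid M] {a : M} {k : ℕ} (hk : 0 < k)
    (ha : a ^ (k + 1) = a) : IsIdempotentElem (a ^ k) := by
  obtain ⟨e, rfl⟩ := Nat.exists_eq_succ_of_ne_zero hk.ne'
  calc a ^ (e + 1) * a ^ (e + 1) = a ^ e * a ^ (e + 1 + 1) := by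
        rw [pow_succ' a (e + 1), ← mul_assoc, ← pow_succ]
    _ = a ^ (e + 1) := by rw [ha, ← pow_succ]

variable {ι R : Type*} [Fintype ι] [DecidableEq ι]

section Semiring

variable [Semiring R] [LinearOrder R] [IsStrictOrderedRing R] {C : Matrix ι ι R}

theorem pow_apply_pos_of_row {k : ℕ} (hk : 0 < k) (h0 : ∀ i j, 0 ≤ C i j) {i j m : ι}
    (hrow : ∀ l, 0 < C i l → 0 < C j l) (h : 0 < (C ^ k) i m) : 0 < (C ^ k) j m := by
  obtain ⟨e, rfl⟩ := Nat.exists_eq_succ_of_ne_zero hk.ne'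
  rw [pow_succ', mul_apply_pos_iff h0 (pow_apply_nonneg h0 e)] at h ⊢
  exact h.imp fun l => And.imp_left (hrow l)

theorem pow_apply_pos_of_col {k : ℕ} (hk : 0 < k) (h0 : ∀ i j, 0 ≤ C i j) {i j m : ι}
    (hcol : ∀ l, 0 < C l i → 0 < C l j) (h : 0 < (C ^ k) m i) : 0 < (C ^ k) m j := by
  obtain ⟨e, rfl⟩ := Nat.exists_eq_succ_of_ne_zero hk.ne'
  rw [pow_succ, mul_apply_pos_iff (pow_apply_nonneg h0 e) h0] at h ⊢
  exact h.imp fun l => And.imp_right (hcol l)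

end Semiring

theorem pow_diag_pos_of_potent [Ring R] [LinearOrder R] [IsStrictOrderedRing R]
    {C : Matrix ι ι R} {k : ℕ} (hk : 0 < k) (h0 : ∀ i j, 0 ≤ C i j)
    (hC : C ^ (k + 1) = C) {i p q : ι} (hq : 0 < C i q) (hp : 0 < C p i) :
    0 < (C ^ k) i i := by
  have hF0 := pow_apply_nonneg h0 k
  obtain ⟨q', hq', -⟩ := (mul_apply_pos_iff hF0 h0).1 (show 0 < (C ^ k * C) i q by
    rwa [← pow_succ, hC])
  obtain ⟨p', -, hp'⟩ := (mul_apply_pos_iff h0 hF0).1 (show 0 < (C * C ^ k) p i by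
    rwa [← pow_succ', hC])
  exact diag_pos_of_idempotent hF0 (isIdempotentElem_pow_of_pow_succ_eq hk hC) hq' hp'

theorem row_proportional_or_col_eq_zero_of_potent [Field R] [LinearOrder R] [IsStrictOrderedRing R]
    {C : Matrix ι ι R} {k : ℕ} (hk : 0 < k) (h0 : ∀ i j, 0 ≤ C i j) (hC : C ^ (k + 1) = C)
    {i j : ι} (hrow : ∀ m, 0 < C i m ↔ 0 < C j m) (hcol : ∀ m, 0 < C m i ↔ 0 < C m j) :
    (∃ r : R, 0 < r ∧ C i = r • C j) ∨ ∀ m, C m i = 0 := by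
  refine or_iff_not_imp_right.2 fun hcol_ne => ?_
  obtain ⟨p, hp⟩ := not_forall.1 hcol_ne
  by_cases hrow_zero : ∀ m, C i m = 0
  · refine ⟨1, one_pos, funext fun m => ?_⟩
    have hjm : C j m = 0 :=
      ((h0 j m).eq_or_lt.resolve_right fun h => ((hrow m).2 h).ne' (hrow_zero m)).symm
    rw [one_smul, hrow_zero, hjm]
  obtain ⟨q, hq⟩ := not_forall.1 hrow_zero
  have hii : 0 < (C ^ k) i i :=
    pow_diag_pos_of_potent hk h0 hC ((h0 i q).lt_of_ne' hq) ((h0 p i).lt_of_ne' hp)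
  obtain ⟨r, hr, hrF⟩ := row_proportional_of_idempotent (pow_apply_nonneg h0 k)
    (isIdempotentElem_pow_of_pow_succ_eq hk hC)
    (pow_apply_pos_of_row hk h0 (fun m => (hrow m).1) hii)
    (pow_apply_pos_of_col hk h0 (fun m => (hcol m).1) hii)
  have hrow_eq : ∀ a, C a = (C ^ k) a ᵥ* C := fun a => by
    rw [← mul_apply_eq_vecMul, ← pow_succ, hC]
  exact ⟨r, hr, by rw [hrow_eq i, hrF, smul_vecMul, ← hrow_eq j]⟩

end Potent

section Ambiguity

variable {R : Type*} [Ring R] [LinearOrder R] [IsStrictOrderedRing R]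

/-- `HasGenSign g x y` says that, unless the generalized sign `g` is ambiguous, `x` has sign `g`
and `y` is the absolute value of `x`. It tracks a sum of products `x` next to the corresponding
sum `y` of products of absolute values: a cancellation in `x` makes `g` ambiguous. -/
def HasGenSign : GenSign → R → R → Prop
  | GenSign.zero, x, y => x = 0 ∧ y = 0
  | GenSign.pos, x, y => 0 < x ∧ y = x
  | GenSign.neg, x, y => x < 0 ∧ y = -x
  | GenSign.amb, _, _ => True

theorem HasGenSign.add {g g' : GenSign} {x x' y y' : R} (h : HasGenSign g x y)
    (h' : HasGenSign g' x' y') : HasGenSign (g + g') (x + x') (y + y') := by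
  change HasGenSign (GenSign.add g g') _ _
  cases g <;> cases g' <;> simp only [HasGenSign, GenSign.add] at h h' ⊢ <;>
    grind

theorem HasGenSign.mul {g g' : GenSign} {x x' y y' : R} (h : HasGenSign g x y)
    (h' : HasGenSign g' x' y') : HasGenSign (g * g') (x * x') (y * y') := by
  change HasGenSign (GenSign.mul g g') _ _
  cases g <;> cases g' <;> simp only [HasGenSign, GenSign.mul] at h h' ⊢ <;>
    simp [h, h', mul_pos_of_neg_of_neg, mul_neg_of_pos_of_neg, mul_neg_of_neg_of_pos]

theorem hasGenSign_ofSign_sign (x : R) : HasGenSign (GenSign.ofSign (SignType.sign x)) x |x| := by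
  rcases lt_trichotomy x 0 with h | rfl | h
  · rw [sign_neg h]
    exact ⟨h, abs_of_neg h⟩
  · rw [sign_zero]
    exact ⟨rfl, abs_zero⟩
  · rw [sign_pos h]
    exact ⟨h, abs_of_pos h⟩

theorem HasGenSign.eq_abs {a : SignType} {x y : R} (h : HasGenSign (GenSign.ofSign a) x y) :
    y = |x| := by
  cases a
  · obtain ⟨rfl, rfl⟩ := h
    exact abs_zero.symm
  · obtain ⟨hx, rfl⟩ := h
    exact (abs_of_neg hx).symm
  · obtain ⟨hx, rfl⟩ := h
    exact (abs_of_pos hx).symm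

variable (R) in
/-- The triples `(g, x, y)` with `HasGenSign g x y`, as a subsemiring: this lets the relation pass
to the entries of matrix powers. -/
def genSignSubsemiring : Subsemiring (GenSign × R × R) where
  carrier := {p | HasGenSign p.1 p.2.1 p.2.2}
  add_mem' := HasGenSign.add
  zero_mem' := ⟨rfl, rfl⟩
  mul_mem' := HasGenSign.mul
  one_mem' := ⟨one_pos, rfl⟩

theorem hasGenSign_pow {n : ℕ} {A : Pattern n} {B : Matrix (Fin n) (Fin n) R}
    (hB : ∀ i j, SignType.sign (B i j) = A i j) (m : ℕ) (i j : Fin n) :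
    HasGenSign ((gen A ^ m) i j) ((B ^ m) i j) ((B.map abs ^ m) i j) := by
  let T : Matrix (Fin n) (Fin n) (GenSign × R × R) :=
    of fun i j => (GenSign.ofSign (A i j), B i j, |B i j|)
  have hT : T ∈ (genSignSubsemiring R).matrix := fun i j => by
    change HasGenSign (GenSign.ofSign (A i j)) (B i j) |B i j|
    rw [← hB i j]
    exact hasGenSign_ofSign_sign (B i j)
  have hgen : (T ^ m).map Prod.fst = gen A ^ m :=
    map_pow (RingHom.fst GenSign (R × R)).mapMatrix T m
  have hB_pow : (T ^ m).map (Prod.fst ∘ Prod.snd) = B ^ m :=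
    map_pow ((RingHom.fst R R).comp (RingHom.snd GenSign (R × R))).mapMatrix T m
  have habs : (T ^ m).map (Prod.snd ∘ Prod.snd) = B.map abs ^ m :=
    map_pow ((RingHom.snd R R).comp (RingHom.snd GenSign (R × R))).mapMatrix T m
  rw [← hgen, ← hB_pow, ← habs]
  exact pow_mem hT m i j

theorem map_abs_pow_succ {n k : ℕ} {A : Pattern n} {B : Matrix (Fin n) (Fin n) R}
    (hA : gen A ^ (k + 1) = gen A) (hB : ∀ i j, SignType.sign (B i j) = A i j)
    (hBk : B ^ (k + 1) = B) : B.map abs ^ (k + 1) = B.map abs := by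
  ext i j
  have h := hasGenSign_pow hB (k + 1) i j
  rw [hA, hBk] at h
  exact h.eq_abs

end Ambiguity

theorem row_proportional_or_col_eq_zero_of_signPotent {R : Type*} [Field R] [LinearOrder R]
    [IsStrictOrderedRing R] {n k : ℕ} (hk : 0 < k) {A : Pattern n}
    {B : Matrix (Fin n) (Fin n) R} (hA : gen A ^ (k + 1) = gen A)
    (hB : ∀ i j, SignType.sign (B i j) = A i j) (hBk : B ^ (k + 1) = B) {i j : Fin n}
    (hrow : ∀ m, A i m = A j m) (hcol : ∀ m, A m i = A m j) :
    (∃ r : R, 0 < r ∧ B i = r • B j) ∨ ∀ m, B m i = 0 := by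
  have habs_pos : ∀ {a b c d}, A a b = A c d → (0 < |B a b| ↔ 0 < |B c d|) := fun h => by
    rw [← hB, ← hB] at h
    rw [abs_pos, abs_pos, ← sign_ne_zero, h, sign_ne_zero]
  refine (row_proportional_or_col_eq_zero_of_potent hk (C := B.map abs) (fun _ _ => abs_nonneg _)
    (map_abs_pow_succ hA hB hBk) (fun m => habs_pos (hrow m)) (fun m => habs_pos (hcol m))).imp
    ?_ fun h m => abs_eq_zero.1 (h m)
  rintro ⟨r, hr, h⟩
  refine ⟨r, hr, funext fun m => ?_⟩
  have hm : |B i m| = r * |B j m| := congrFun h m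
  calc B i m = SignType.sign (B i m) * |B i m| := (sign_mul_abs _).symm
    _ = r * (SignType.sign (B j m) * |B j m|) := by rw [hB, hB, hrow, hm, mul_left_comm]
    _ = r * B j m := by rw [sign_mul_abs]

section Compression

variable {ι κ μ R : Type*} [Semiring R]

theorem compression_pow [Fintype ι] [DecidableEq ι] [Fintype κ] [DecidableEq κ]
    (V : Matrix κ ι R) (B : Matrix ι ι R) (U : Matrix ι κ R) (h : B * (U * V * B) = B * B)
    (m : ℕ) : (V * B * U) ^ (m + 1) = V * B ^ (m + 1) * U := by
  induction m with
  | zero => simp only [zero_add, pow_one]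
  | succ m ih =>
    calc (V * B * U) ^ (m + 1 + 1) = V * B ^ m * (B * (U * V * B)) * U := by
          rw [pow_succ, ih]; simp only [pow_succ, Matrix.mul_assoc]
      _ = V * B ^ (m + 1 + 1) * U := by
          rw [h]; simp only [pow_succ, Matrix.mul_assoc]

variable [DecidableEq κ]

/-- The `ι × κ` matrix whose row `i` has the single entry `w i`, in column `f i`. For `f` the map
from indices to blocks it turns a sum over a block into a matrix product. -/
def fiberMatrix (f : ι → κ) (w : ι → R) : Matrix ι κ R :=
  of fun i s => if f i = s then w i else 0

theorem fiberMatrix_mul_apply [Fintype κ] (f : ι → κ) (w : ι → R) (M : Matrix κ μ R) (i : ι)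
    (t : μ) : (fiberMatrix f w * M) i t = w i * M (f i) t := by
  simp [fiberMatrix, mul_apply]

theorem mul_fiberMatrix_apply [Fintype ι] (f : ι → κ) (w : ι → R) (M : Matrix μ ι R) (a : μ)
    (s : κ) : (M * fiberMatrix f w) a s = ∑ i with f i = s, M a i * w i := by
  simp [fiberMatrix, mul_apply, Finset.sum_filter]

theorem mul_transpose_fiberMatrix_apply [Fintype κ] (f : ι → κ) (w : ι → R) (M : Matrix μ κ R)
    (a : μ) (i : ι) : (M * (fiberMatrix f w)ᵀ) a i = M a (f i) * w i := by
  simp [fiberMatrix, mul_apply]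

theorem transpose_fiberMatrix_mul_fiberMatrix_one [Fintype ι] (f : ι → κ) (w : ι → R)
    (hw : ∀ s, ∑ i with f i = s, w i = 1) : (fiberMatrix f w)ᵀ * fiberMatrix f (1 : ι → R) = 1 := by
  ext s t
  rw [mul_fiberMatrix_apply]
  simp only [fiberMatrix, transpose_apply, of_apply, Pi.one_apply, mul_one]
  rcases eq_or_ne s t with rfl | hst
  · rw [one_apply_eq, ← hw s]
    exact Finset.sum_congr rfl fun i hi => if_pos (Finset.mem_filter.1 hi).2
  · rw [one_apply_ne hst]
    exact Finset.sum_eq_zero fun i hi => if_neg fun his =>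
      hst (his.symm.trans (Finset.mem_filter.1 hi).2)

end Compression

section BlowUp

variable {m n k : ℕ} {f : Fin n → Fin m} {S : Pattern m}

theorem AllowsKPotence.submatrix (hf : f.Surjective) (h : AllowsKPotence k S) :
    AllowsKPotence k (S.submatrix f f) := by
  obtain ⟨C, hC, hCk⟩ := h
  let size : Fin m → ℝ := fun s => ({i | f i = s} : Finset (Fin n)).card
  have hsize : ∀ s, 0 < size s := fun s =>
    Nat.cast_pos.2 (Finset.card_pos.2 ((hf s).imp fun i hi => by simpa using hi))
  let w : Fin n → ℝ := fun i => (size (f i))⁻¹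
  have hw : ∀ s, ∑ i with f i = s, w i = 1 := fun s => by
    calc ∑ i with f i = s, w i = ∑ i with f i = s, (size s)⁻¹ :=
          Finset.sum_congr rfl fun i hi => by simp only [w, (Finset.mem_filter.1 hi).2]
      _ = 1 := by rw [Finset.sum_const, nsmul_eq_mul, mul_inv_cancel₀ (hsize s).ne']
  let U : Matrix (Fin n) (Fin m) ℝ := fiberMatrix f 1
  let V : Matrix (Fin m) (Fin n) ℝ := (fiberMatrix f w)ᵀ
  have hVU : V * U = 1 := transpose_fiberMatrix_mul_fiberMatrix_one f w hw
  refine ⟨U * C * V, fun i j => ?_, ?_⟩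
  · rw [mul_transpose_fiberMatrix_apply, fiberMatrix_mul_apply, Pi.one_apply, one_mul, sign_mul,
      sign_pos (inv_pos.2 (hsize _)), mul_one, hC, submatrix_apply]
  · rw [compression_pow U C V (by rw [hVU, Matrix.one_mul]), hCk]

theorem AllowsKPotence.of_submatrix (hk : 0 < k) (hf : f.Surjective)
    (hA : gen (S.submatrix f f) ^ (k + 1) = gen (S.submatrix f f))
    (h : AllowsKPotence k (S.submatrix f f)) : AllowsKPotence k S := by
  obtain ⟨B, hB, hBk⟩ := h
  let g : Fin m → Fin n := Function.surjInv hf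
  have hfg : ∀ s, f (g s) = s := Function.surjInv_eq hf
  have hprop : ∀ i, ∃ r : ℝ, 0 < r ∧ (B i = r • B (g (f i)) ∨ ∀ l, B l i = 0) := fun i => by
    rcases row_proportional_or_col_eq_zero_of_signPotent hk hA hB hBk (i := i) (j := g (f i))
      (fun l => by simp only [submatrix_apply, hfg])
      (fun l => by simp only [submatrix_apply, hfg]) with ⟨r, hr, hrow⟩ | hcol
    · exact ⟨r, hr, Or.inl hrow⟩
    · exact ⟨1, one_pos, Or.inr hcol⟩
  choose w hw hprop using hprop
  let U : Matrix (Fin n) (Fin m) ℝ := fiberMatrix f w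
  let V : Matrix (Fin m) (Fin n) ℝ := fiberMatrix g 1
  have hcompress : B * (U * V * B) = B * B := by
    ext a b
    rw [mul_apply, mul_apply]
    refine Finset.sum_congr rfl fun i _ => ?_
    rw [Matrix.mul_assoc, fiberMatrix_mul_apply, fiberMatrix_mul_apply, Pi.one_apply, one_mul]
    rcases hprop i with hrow | hcol
    · rw [congrFun hrow b, Pi.smul_apply, smul_eq_mul]
    · rw [hcol, zero_mul, zero_mul]
  refine ⟨V * B * U, fun s t => ?_, by rw [compression_pow V B U hcompress, hBk]⟩
  rw [mul_fiberMatrix_apply]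
  refine sign_sum ((hf t).imp fun j hj => by simpa using hj) _ fun j hj => ?_
  rw [fiberMatrix_mul_apply, Pi.one_apply, one_mul, sign_mul, sign_pos (hw j), mul_one, hB,
    submatrix_apply, hfg, (Finset.mem_filter.1 hj).2]

end BlowUp

theorem isConstantOnBlocks_coarsest {n : ℕ} (A : Pattern n) :
    IsConstantOnBlocks A (coarsest A) :=
  (exists_isCoarsest A).choose_spec.1

theorem surjective_index {n : ℕ} (c : Composition n) : Function.Surjective c.index := fun s =>
  ⟨c.embedding s ⟨0, c.one_le_blocksFun s⟩, c.index_embedding s _⟩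

theorem red_submatrix_index {n : ℕ} (A : Pattern n) :
    (red A).submatrix (coarsest A).index (coarsest A).index = A := by
  ext i j
  exact isConstantOnBlocks_coarsest A _ _ _ _ ((coarsest A).index_embedding _ _)
    ((coarsest A).index_embedding _ _)

end SignPattern

theorem theorem2p5_general {n k : ℕ} (A : SignPattern.Pattern n) (hk : 0 < k)
    (hA : SignPattern.gen A ^ (k + 1) = SignPattern.gen A) :
    SignPattern.AllowsKPotence k A ↔ SignPattern.AllowsKPotence k (SignPattern.red A) := by
  have hred := SignPattern.red_submatrix_index A
  have hsurj := SignPattern.surjective_index (SignPattern.coarsest A)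
  refine ⟨fun h => ?_, fun h => hred ▸ h.submatrix hsurj⟩
  exact SignPattern.AllowsKPotence.of_submatrix hk hsurj (by rwa [hred]) (by rwa [hred])

theorem theorem2p5 {n k : ℕ} (A : SignPattern.Pattern n)
    (hred : SignPattern.IsReducible A)
    (hpot : SignPattern.IsSignKPotent k A)
    (hcyc : SignPattern.IsCyclicNormalForm A) :
    SignPattern.AllowsKPotence k A ↔ SignPattern.AllowsKPotence k (SignPattern.red A) :=
  theorem2p5_general A hpot.1.1 hpot.1.2
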